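/- Throughout, $\mathbb R_+=[0,\infty)$, and a property of $s$ holds "near $\infty$" ("near $0$") if there is $s_0>0$ such that it holds for all $s\ge s_0$ (for all $0<s\le s_0$). **Control semigroups.** A *large scale dim-control function* is a continuous increasing $g:\mathbb R_+\to\mathbb R_+$ with $g(x)\ge x$ near $\infty$ and $\lim_{x\to\infty}g(x)=\infty$. It is a *global dim-control function* if moreover $g(x)\ge x$ near $0$ and $g(0)=0$. A *(large scale) control semigroup* is a set $\mathcal S$ of large scale dim-control functions that is closed under composition and contains every such function that is equal to a linear function $x\mapsto cx$ near $\infty$. A *global control semigroup* is a set $\bar{\mathcal S}$ of global dim-control functions that is closed under composition and contains every such function that is equal to a linear function near $0$ and to a (possibly different) linear function near $\infty$. Here "increasing" means non-decreasing; the semigroups need only contain the strictly increasing functions among the linear ones just described, so the result also holds if "increasing" is read strictly throughout. **Dimension of spaces.** Let $X$ be a metric space. A subset is $C$-bounded if its diameter is at most $C$. A family of subsets is $s$-disjoint if $d(U,V)=\inf\{d(x,y):x\in U,\,y\in V\}>s$ for all distinct members $U,V$. Then $\mathrm{asdim}_{\mathcal S}X$ is the least integer $n\ge 0$ for which there is $g\in\mathcal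 S$ such that for all $s$ near $\infty$ there is a cover $\mathcal U=\bigcup_{i=1}^{n+1}\mathcal U_i$ of $X$ with every $\mathcal U_i$ $s$-disjoint and consisting of $g(s)$-bounded sets. The global dimension $\dim_{\bar{\mathcal S}}X$ is defined in the same way, with $g\in\bar{\mathcal S}$ and with covers for every $s>0$. All dimensions are $\infty$ if there is no such integer. **Maps.** Let $f:X\to Y$ be a function between metric spaces. It is a *$\Sigma(\mathcal S)$-coarse map* if there are a continuous increasing $\rho:\mathbb R_+\to\mathbb R_+$ with $\lim_{x\to\infty}\rho(x)=\infty$ and some $g\in\mathcal S$ with $\rho\le g$ near $\infty$ such that $d_Y(f(x),f(y))\le\rho(d_X(x,y))$ for all $x,y\in X$. It is a *global $\Sigma(\bar{\mathcal S})$-map* if this holds with $g\in\bar{\mathcal S}$, $\rho(0)=0$, and $\rho\le g$ near $0$ as well as near $\infty$. **Dimension of maps.** Let $\mathcal S_1,\mathcal S_2$ be control semigroups. A function $D:\mathbb R_+\times\mathbb R_+\to\mathbb R_+$ is an *$(\mathcal S_1,\mathcal S_2)$-function* if for all $\rho_1\in\mathcal S_1$ and $\delta\in\mathcal S_2$ there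 is $\rho_2\in\mathcal S_1$ with $D(\rho_1(x),\delta(x))\le\rho_2(x)$ near $\infty$. The $r$-components of a set are its classes of points that can be joined by finite chains in the set with steps of length at most $r$. An *$m$-dimensional $(\mathcal S_1,\mathcal S_2)$-control function* of $f$ is an $(\mathcal S_1,\mathcal S_2)$-function $D$ for which there is $t$ such that for all $r,R\ge t$ every $A\subset X$ with $d_Y(f(x),f(y))\le R$ for all $x,y\in A$ is a union of $m+1$ sets whose $r$-components are $D(r,R)$-bounded. The dimension $\mathrm{asdim}_{(\mathcal S_1,\mathcal S_2)}(f)$ is the least $m\ge 0$ for which such a $D$ exists. For global control semigroups, $\dim_{(\bar{\mathcal S}_1,\bar{\mathcal S}_2)}(f)$ is defined in the same way, with the inequality $D(\rho_1(x),\delta(x))\le\rho_2(x)$ required near $0$ and near $\infty$, and with the decompositions required for all $r,R\ge t$ for some $t$ and for all $0<r,R\le t'$ for some $t'>0$. **Theorem.** Let $f:X\to Y$ be a function between metric spaces. 1. Let $\mathcal S_1,\mathcal S_2$ be control semigroups. If $f$ is a $\Sigma(\mathcal S_2)$-coarse map, then $$\mathrm{asdim}_{\mathcal S_1}X\le \mathrm{asdim}_{(\mathcal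 S_1,\mathcal S_2)}(f)+\mathrm{asdim}_{\mathcal S_2}Y.$$ 2. Let $\bar{\mathcal S}_1,\bar{\mathcal S}_2$ be global control semigroups. If $f$ is a global $\Sigma(\bar{\mathcal S}_2)$-map, then $$\dim_{\bar{\mathcal S}_1}X\le \dim_{(\bar{\mathcal S}_1,\bar{\mathcal S}_2)}(f)+\dim_{\bar{\mathcal S}_2}Y.$$ -/

import Mathlib

open Filter Topology
open scoped NNReal ENNReal

namespace ControlledDim

/-! ## Control semigroups

`ℝ₊ = [0, ∞)` is `ℝ≥0`. "In a neighbourhood of `∞`" is `∀ᶠ x in atTop`, and "in a neighbourhood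
of `0`", for positive reals, is `∀ᶠ x in 𝓝[>] 0`. -/

/-- Large scale dim-control functions: increasing, continuous, `f x ≥ x` in a neighbourhood of `∞`,
and `f(∞) = ∞`. -/
structure IsDimControl (f : ℝ≥0 → ℝ≥0) : Prop where
  mono : Monotone f
  cont : Continuous f
  le_atTop : ∀ᶠ x in atTop, x ≤ f x
  tendsto_atTop : Tendsto f atTop atTop

/-- Global dim-control functions: both large scale and small scale dim-control functions. -/
structure IsGlobalDimControl (f : ℝ≥0 → ℝ≥0) : Prop extends IsDimControl f where
  le_zero : ∀ᶠ x in 𝓝[>] 0, x ≤ f x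
  map_zero : f 0 = 0

/-- `f` is equal to some linear function in a neighbourhood of `∞`. -/
def LinearAtTop (f : ℝ≥0 → ℝ≥0) : Prop := ∃ c : ℝ≥0, ∀ᶠ x in atTop, f x = c * x

/-- `f` is equal to some linear function in a neighbourhood of `0`. -/
def LinearAtZero (f : ℝ≥0 → ℝ≥0) : Prop := ∃ c : ℝ≥0, ∀ᶠ x in 𝓝[>] 0, f x = c * x

/-- (Large scale) control semigroups: sets of dim-control functions that contain the asymptotically
linear ones and are closed under composition.  Members of `S` may be only weakly increasing, and the
linear condition is imposed only for strictly increasing functions: control semigroups in either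
sense of the word "increasing" (weakly or strictly, throughout) are therefore covered. -/
structure IsControlSemigroup (S : Set (ℝ≥0 → ℝ≥0)) : Prop where
  dimControl : ∀ f ∈ S, IsDimControl f
  linear : ∀ f, StrictMono f → IsDimControl f → LinearAtTop f → f ∈ S
  comp : ∀ f ∈ S, ∀ g ∈ S, f ∘ g ∈ S

/-- Global control semigroups; "increasing" is treated as in `IsControlSemigroup`. -/
structure IsGlobalControlSemigroup (S : Set (ℝ≥0 → ℝ≥0)) : Prop where
  dimControl : ∀ f ∈ S, IsGlobalDimControl f
  linear : ∀ f, StrictMono f → IsGlobalDimControl f → LinearAtZero f → LinearAtTop f → f ∈ S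
  comp : ∀ f ∈ S, ∀ g ∈ S, f ∘ g ∈ S

/-! ## Dimension of metric spaces -/

section Space

variable {X : Type*} [MetricSpace X]

/-- The distance `d(U, V) = inf {d(x, y) : x ∈ U, y ∈ V}` of two sets (`∞` if one is empty). -/
noncomputable def setDist (U V : Set X) : ℝ≥0∞ := ⨅ x ∈ U, ⨅ y ∈ V, edist x y

/-- The family `𝒰` is `s`-disjoint. -/
def IsDisjointFamily (s : ℝ≥0) (𝒰 : Set (Set X)) : Prop :=
  ∀ U ∈ 𝒰, ∀ V ∈ 𝒰, U ≠ V → (s : ℝ≥0∞) < setDist U V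

/-- The set `U` is `C`-bounded: `diam U ≤ C`. -/
def IsBoundedBy (C : ℝ≥0) (U : Set X) : Prop := Metric.ediam U ≤ (C : ℝ≥0∞)

/-- `X` has a coloured cover `𝒰 = 𝒰₀ ∪ ⋯ ∪ 𝒰ₙ`, each `𝒰ᵢ` being `s`-disjoint and `C`-bounded. -/
def HasColouredCover (X : Type*) [MetricSpace X] (n : ℕ) (s C : ℝ≥0) : Prop :=
  ∃ 𝒰 : Fin (n + 1) → Set (Set X), (⋃ i, ⋃₀ 𝒰 i) = Set.univ ∧
    ∀ i, IsDisjointFamily s (𝒰 i) ∧ ∀ U ∈ 𝒰 i, IsBoundedBy C U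

/-- `asdim_S X ≤ n`. -/
def AsdimLE (S : Set (ℝ≥0 → ℝ≥0)) (X : Type*) [MetricSpace X] (n : ℕ) : Prop :=
  ∃ f ∈ S, ∀ᶠ s in atTop, HasColouredCover X n s (f s)

/-- Global dimension: `dim_S X ≤ n`, where the covers exist at every scale `s > 0`. -/
def GlobalDimLE (S : Set (ℝ≥0 → ℝ≥0)) (X : Type*) [MetricSpace X] (n : ℕ) : Prop :=
  ∃ f ∈ S, ∀ s : ℝ≥0, 0 < s → HasColouredCover X n s (f s)

/-- `asdim_S X`, the least `n` with `asdim_S X ≤ n` (`∞` if there is none). -/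
noncomputable def asdim (S : Set (ℝ≥0 → ℝ≥0)) (X : Type*) [MetricSpace X] : ℕ∞ :=
  ⨅ (n : ℕ) (_ : AsdimLE S X n), (n : ℕ∞)

/-- `dim_S X`, the least `n` with `dim_S X ≤ n` (`∞` if there is none). -/
noncomputable def globalDim (S : Set (ℝ≥0 → ℝ≥0)) (X : Type*) [MetricSpace X] : ℕ∞ :=
  ⨅ (n : ℕ) (_ : GlobalDimLE S X n), (n : ℕ∞)

/-- The `r`-component of the point `x` in the set `A`: all points of `A` that are reached from `x`
by a finite chain in `A` with steps of length at most `r`. -/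
def component (r : ℝ≥0) (A : Set X) (x : X) : Set X :=
  {y | y ∈ A ∧ Relation.ReflTransGen (fun a b => a ∈ A ∧ b ∈ A ∧ nndist a b ≤ r) x y}

end Space

/-! ## Maps and their dimension -/

/-- The metric perturbation set `Σ(S)` of a control semigroup `S`. -/
def perturbations (S : Set (ℝ≥0 → ℝ≥0)) : Set (ℝ≥0 → ℝ≥0) :=
  {ρ | Monotone ρ ∧ Continuous ρ ∧ Tendsto ρ atTop atTop ∧ ∃ g ∈ S, ∀ᶠ x in atTop, ρ x ≤ g x}

/-- The global metric perturbation set `Σ(S)` of a global control semigroup `S`. -/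
def globalPerturbations (S : Set (ℝ≥0 → ℝ≥0)) : Set (ℝ≥0 → ℝ≥0) :=
  {ρ | Monotone ρ ∧ Continuous ρ ∧ ρ 0 = 0 ∧ Tendsto ρ atTop atTop ∧
    ∃ g ∈ S, (∀ᶠ x in 𝓝[>] 0, ρ x ≤ g x) ∧ ∀ᶠ x in atTop, ρ x ≤ g x}

/-- `D` is an `(S₁, S₂)`-function. -/
def IsPairFunction (S₁ S₂ : Set (ℝ≥0 → ℝ≥0)) (D : ℝ≥0 → ℝ≥0 → ℝ≥0) : Prop :=
  ∀ ρ₁ ∈ S₁, ∀ δ ∈ S₂, ∃ ρ₂ ∈ S₁, ∀ᶠ x in atTop, D (ρ₁ x) (δ x) ≤ ρ₂ x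

/-- `D` is a global `(S₁, S₂)`-function: the inequality holds near `0` and near `∞`. -/
def IsGlobalPairFunction (S₁ S₂ : Set (ℝ≥0 → ℝ≥0)) (D : ℝ≥0 → ℝ≥0 → ℝ≥0) : Prop :=
  ∀ ρ₁ ∈ S₁, ∀ δ ∈ S₂, ∃ ρ₂ ∈ S₁,
    (∀ᶠ x in 𝓝[>] 0, D (ρ₁ x) (δ x) ≤ ρ₂ x) ∧ ∀ᶠ x in atTop, D (ρ₁ x) (δ x) ≤ ρ₂ x

section Map

variable {X Y : Type*} [MetricSpace X] [MetricSpace Y]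

/-- `f` is a `Σ(S)`-coarse map. -/
def IsCoarseMap (S : Set (ℝ≥0 → ℝ≥0)) (f : X → Y) : Prop :=
  ∃ ρ ∈ perturbations S, ∀ x y, nndist (f x) (f y) ≤ ρ (nndist x y)

/-- `f` is a global `Σ(S)`-map. -/
def IsGlobalMap (S : Set (ℝ≥0 → ℝ≥0)) (f : X → Y) : Prop :=
  ∃ ρ ∈ globalPerturbations S, ∀ x y, nndist (f x) (f y) ≤ ρ (nndist x y)

/-- The subset `A` of `X` is `(r, R)`-bounded with respect to `f`; `r = ∞` is allowed. -/
def IsPairBounded (f : X → Y) (r : ℝ≥0∞) (R : ℝ≥0) (A : Set X) : Prop :=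
  ∀ x ∈ A, ∀ y ∈ A, edist x y ≤ r → nndist (f x) (f y) ≤ R

/-- Every `(∞, R)`-bounded subset of `X` is the union of `m + 1` sets whose `r`-components are
`C`-bounded. -/
def FibresDecompose (f : X → Y) (m : ℕ) (r R C : ℝ≥0) : Prop :=
  ∀ A : Set X, IsPairBounded f ⊤ R A → ∃ B : Fin (m + 1) → Set X, A = ⋃ i, B i ∧
    ∀ i, ∀ x ∈ B i, IsBoundedBy C (component r (B i) x)

/-- `D` is an `m`-dimensional `(S₁, S₂)`-control function of `f`: it is an `(S₁, S₂)`-function, and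
the decomposition exists for all `r` and `R` in a neighbourhood of `∞`. -/
def IsControlFunction (S₁ S₂ : Set (ℝ≥0 → ℝ≥0)) (f : X → Y) (m : ℕ) (D : ℝ≥0 → ℝ≥0 → ℝ≥0) :
    Prop :=
  IsPairFunction S₁ S₂ D ∧ ∃ t : ℝ≥0, ∀ r R, t ≤ r → t ≤ R → FibresDecompose f m r R (D r R)

/-- `D` is an `m`-dimensional global `(S₁, S₂)`-control function of `f`: it is a global
`(S₁, S₂)`-function, and the decomposition exists for all positive `r` and `R` in a neighbourhood of
`0`, and for all `r` and `R` in a neighbourhood of `∞`. -/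
def IsGlobalControlFunction (S₁ S₂ : Set (ℝ≥0 → ℝ≥0)) (f : X → Y) (m : ℕ)
    (D : ℝ≥0 → ℝ≥0 → ℝ≥0) : Prop :=
  IsGlobalPairFunction S₁ S₂ D ∧
    (∃ t : ℝ≥0, 0 < t ∧ ∀ r R, 0 < r → r ≤ t → 0 < R → R ≤ t → FibresDecompose f m r R (D r R)) ∧
    ∃ t : ℝ≥0, ∀ r R, t ≤ r → t ≤ R → FibresDecompose f m r R (D r R)

/-- `asdim_{(S₁, S₂)}(f)`, the least `m` for which there is an `m`-dimensional
`(S₁, S₂)`-control function of `f` (`∞` if there is none). -/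
noncomputable def asdimMap (S₁ S₂ : Set (ℝ≥0 → ℝ≥0)) (f : X → Y) : ℕ∞ :=
  ⨅ (m : ℕ) (_ : ∃ D, IsControlFunction S₁ S₂ f m D), (m : ℕ∞)

/-- `dim_{(S₁, S₂)}(f)`, the least `m` for which there is an `m`-dimensional global
`(S₁, S₂)`-control function of `f` (`∞` if there is none). -/
noncomputable def globalDimMap (S₁ S₂ : Set (ℝ≥0 → ℝ≥0)) (f : X → Y) : ℕ∞ :=
  ⨅ (m : ℕ) (_ : ∃ D, IsGlobalControlFunction S₁ S₂ f m D), (m : ℕ∞)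

end Map

end ControlledDim

open ControlledDim

/-! The preimages under `f` of the `n + 1` disjoint families covering `Y` are absorbed one family at
a time, each costing one colour. The empty union is given `m` colours; after `n + 1` rounds all of
`X` has `m + n + 1`. One round (`Colourable.union_preimage`) starts from a set `Z` with `c` colours.
Kolmogorov's trick (`Colourable.exists_two`) turns these into `c + 1` colours with every point of
`Z` coloured twice. Around the union of the new family in `Y`, consecutive shells of width `s` are
drawn, and colour `i` is erased on the preimage of the `i`-th shell. The shells are disjoint, so
every point keeps a colour. A step of a chain changes the distance to the family by at most `s`, so
no chain of colour `i` crosses its shell. Outside, the chain is an old one; inside, it stays near a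
single member `V`, where the pieces of the preimage of `V` may be added by `ChainBounded.union`. All
bounds stay in the first semigroup, being built from it by composition and linear maps. One argument
along a filter serves both statements. -/

namespace ControlledDim

/-! ### Chains, colourings and Kolmogorov's trick. -/

section Chains

variable {X : Type*} [MetricSpace X]

/-- One step of an `r`-chain in `A`. -/
def Step (r : ℝ≥0) (A : Set X) (a b : X) : Prop := a ∈ A ∧ b ∈ A ∧ nndist a b ≤ r

/-- All `r`-chains in `A` have their end points at distance at most `C`. -/
def ChainBounded (r C : ℝ≥0) (A : Set X) : Prop :=
  ∀ x ∈ A, ∀ y, Relation.ReflTransGen (Step r A) x y → nndist x y ≤ C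

theorem Step.symm {r : ℝ≥0} {A : Set X} {a b : X} (h : Step r A a b) : Step r A b a :=
  ⟨h.2.1, h.1, by rw [nndist_comm]; exact h.2.2⟩

theorem chain_symm {r : ℝ≥0} {A : Set X} {a b : X} (h : Relation.ReflTransGen (Step r A) a b) :
    Relation.ReflTransGen (Step r A) b a := by
  induction h with
  | refl => exact .refl
  | tail _ h ih => exact .head h.symm ih

theorem chain_mem {r : ℝ≥0} {A : Set X} {a b : X} (ha : a ∈ A)
    (h : Relation.ReflTransGen (Step r A) a b) : b ∈ A := by
  cases h with
  | refl => exact ha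
  | tail _ h => exact h.2.1

theorem ChainBounded.mono {r r' C C' : ℝ≥0} {A A' : Set X} (h : ChainBounded r C A)
    (hr : r' ≤ r) (hC : C ≤ C') (hA : A' ⊆ A) : ChainBounded r' C' A' := fun x hx y hxy =>
  (h x (hA hx) y (Relation.ReflTransGen.mono
    (fun _ _ h => ⟨hA h.1, hA h.2.1, h.2.2.trans hr⟩) _ _ hxy)).trans hC

theorem chainBounded_empty (r C : ℝ≥0) : ChainBounded r C (∅ : Set X) := fun _ hx => hx.elim

theorem isBoundedBy_iff {C : ℝ≥0} {U : Set X} :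
    IsBoundedBy C U ↔ ∀ x ∈ U, ∀ y ∈ U, nndist x y ≤ C := by
  simp only [IsBoundedBy, Metric.ediam_le_iff, edist_nndist, ENNReal.coe_le_coe]

theorem chainBounded_iff {r C : ℝ≥0} {A : Set X} :
    ChainBounded r C A ↔ ∀ x ∈ A, IsBoundedBy C (component r A x) := by
  simp only [isBoundedBy_iff]
  constructor
  · intro h x hx y hy z hz
    exact h y hy.1 z ((chain_symm hy.2).trans hz.2)
  · intro h x hx y hxy
    exact h x hx x ⟨hx, .refl⟩ y ⟨chain_mem hx hxy, hxy⟩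

/-- Points within `r` of `U` have `r`-chains controlled by the `3r`-chains of `U`. -/
theorem ChainBounded.thickening {r B : ℝ≥0} {U : Set X} (h : ChainBounded (3 * r) B U) :
    ChainBounded r (B + 2 * r) {x | ∃ u ∈ U, nndist x u ≤ r} := by
  rintro x ⟨u, hu, hxu⟩ y hxy
  -- The chain is shadowed by points of `U`; consecutive shadows are within `r + r + r`.
  have key : ∃ v ∈ U, nndist y v ≤ r ∧ Relation.ReflTransGen (Step (3 * r) U) u v := by
    induction hxy with
    | refl => exact ⟨u, hu, hxu, .refl⟩
    | @tail b c _ hs ih =>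
      obtain ⟨v, hv, hbv, huv⟩ := ih
      obtain ⟨-, ⟨w, hw, hcw⟩, hbc⟩ := hs
      refine ⟨w, hw, hcw, huv.tail ⟨hv, hw, ?_⟩⟩
      calc nndist v w ≤ nndist v b + nndist b c + nndist c w :=
            (nndist_triangle v c w).trans (add_le_add_left (nndist_triangle v b c) _)
        _ ≤ r + r + r := by
            rw [nndist_comm v b]; gcongr
        _ = 3 * r := by ring
  obtain ⟨v, hv, hyv, huv⟩ := key
  calc nndist x y ≤ nndist x u + nndist u v + nndist v y :=
        (nndist_triangle x v y).trans (add_le_add_left (nndist_triangle x u v) _)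
    _ ≤ r + B + r := by
        rw [nndist_comm v y]; gcongr; exact h u hu v huv
    _ = B + 2 * r := by ring

/-- A set with `β`-bounded `r`-chains can be added to a set whose pieces are far apart. -/
theorem ChainBounded.union {r r' β C : ℝ≥0} {U P : Set X} (hU : ChainBounded r β U)
    (hP : ChainBounded r' C P) (hr : β + 2 * r ≤ r') :
    ChainBounded r (C + 2 * β + 2 * r) (U ∪ P) := by
  intro x hx y hxy
  -- Here `p` and `q` are the first and the latest visit to `P`. An excursion through `U` between
  -- two visits covers at most `r + β + r ≤ r'`, so the visits form an `r'`-chain in `P`.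
  have key : (x ∈ U ∧ Relation.ReflTransGen (Step r U) x y) ∨
      ∃ p ∈ P, ∃ q ∈ P, nndist x p ≤ β + r ∧ Relation.ReflTransGen (Step r' P) p q ∧
        (y = q ∨ ∃ u ∈ U, nndist q u ≤ r ∧ Relation.ReflTransGen (Step r U) u y) := by
    induction hxy with
    | refl =>
      rcases hx with hx | hx
      · exact .inl ⟨hx, .refl⟩
      · exact .inr ⟨x, hx, x, hx, by simp, .refl, .inl rfl⟩
    | @tail b c _ hs ih =>
      obtain ⟨-, hc, hbc⟩ := hs
      rcases ih with ⟨hxU, hxb⟩ | ⟨p, hp, q, hq, hxp, hpq, hb⟩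
      · rcases hc with hc | hc
        · exact .inl ⟨hxU, hxb.tail ⟨chain_mem hxU hxb, hc, hbc⟩⟩
        · exact .inr ⟨c, hc, c, hc, (nndist_triangle x b c).trans
            (add_le_add (hU x hxU b hxb) hbc), .refl, .inl rfl⟩
      · rcases hc with hc | hc
        · refine .inr ⟨p, hp, q, hq, hxp, hpq, .inr ?_⟩
          rcases hb with rfl | ⟨u, hu, hqu, hub⟩
          · exact ⟨c, hc, hbc, .refl⟩
          · exact ⟨u, hu, hqu, hub.tail ⟨chain_mem hu hub, hc, hbc⟩⟩
        · refine .inr ⟨p, hp, c, hc, hxp, hpq.tail ⟨hq, hc, le_trans ?_ hr⟩, .inl rfl⟩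
          rcases hb with rfl | ⟨u, hu, hqu, hub⟩
          · refine hbc.trans ?_
            rw [two_mul, ← add_assoc]
            exact le_add_self
          · calc nndist q c ≤ nndist q u + nndist u b + nndist b c :=
                  (nndist_triangle q b c).trans (add_le_add_left (nndist_triangle q u b) _)
              _ ≤ r + β + r := by gcongr; exact hU u hu b hub
              _ = β + 2 * r := by ring
  rcases key with ⟨hxU, hxy⟩ | ⟨p, hp, q, hq, hxp, hpq, hy⟩
  · refine (hU x hxU y hxy).trans ?_
    calc β ≤ β + (C + β + 2 * r) := le_self_add
      _ = _ := by ring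
  · have hqy : nndist q y ≤ r + β := by
      rcases hy with rfl | ⟨u, hu, hqu, huy⟩
      · simp
      · exact (nndist_triangle q u y).trans (add_le_add hqu (hU u hu y huy))
    calc nndist x y ≤ nndist x p + nndist p q + nndist q y :=
          (nndist_triangle x q y).trans (add_le_add_left (nndist_triangle x p q) _)
      _ ≤ (β + r) + C + (r + β) := by gcongr; exact hP p hp q hpq
      _ = C + 2 * β + 2 * r := by ring

/-- `Z` is the union of `c` sets with `C`-bounded `r`-chains. -/
def Colourable (c : ℕ) (r C : ℝ≥0) (Z : Set X) : Prop :=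
  ∃ U : ℕ → Set X, Z = ⋃ i < c, U i ∧ ∀ i < c, ChainBounded r C (U i)

/-- Kolmogorov's trick: one more colour makes every point coloured at least twice. -/
theorem Colourable.exists_two {c : ℕ} {r B : ℝ≥0} {Z : Set X} (h : Colourable c (3 * r) B Z) :
    ∃ U : ℕ → Set X, (∀ i < c + 1, U i ⊆ Z) ∧ (∀ i < c + 1, ChainBounded r (B + 2 * r) (U i)) ∧
      ∀ x ∈ Z, ∃ i < c + 1, ∃ j < c + 1, i ≠ j ∧ x ∈ U i ∧ x ∈ U j := by
  obtain ⟨U, rfl, hU⟩ := h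
  set Z := ⋃ i < c, U i with hZ
  have memZ : ∀ x, x ∈ Z ↔ ∃ i < c, x ∈ U i := fun x => by simp [hZ]
  let N : ℕ → Set X := fun i => {x | ∃ u ∈ U i, nndist x u ≤ r}
  -- The points near only one colour. They receive the new colour `c` as their second one; all other
  -- points of `Z` already lie in two of the `N i`.
  let W : Set X := {x | x ∈ Z ∧ ∀ i < c, ∀ j < c, x ∈ N i → x ∈ N j → i = j}
  have hUN : ∀ i, U i ⊆ N i := fun i x hx => ⟨x, hx, by simp⟩
  refine ⟨fun i => if i < c then N i ∩ Z else W, ?_, ?_, ?_⟩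
  · intro i _
    dsimp only
    split_ifs
    · exact Set.inter_subset_right
    · exact fun x hx => hx.1
  · intro i _
    dsimp only
    split_ifs with hi
    · exact (hU i hi).thickening.mono le_rfl le_rfl Set.inter_subset_left
    · intro x hx y hxy
      obtain ⟨k, hk, hxk⟩ := (memZ x).1 hx.1
      have key : y ∈ U k ∧ Relation.ReflTransGen (Step (3 * r) (U k)) x y := by
        induction hxy with
        | refl => exact ⟨hxk, .refl⟩
        | @tail b d _ hs ih =>
          obtain ⟨hb, hd, hbd⟩ := hs
          obtain ⟨k', hk', hdk'⟩ := (memZ d).1 hd.1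
          -- A step from `b` into `U k'` puts `b` in `N k'`, so a chain in `W` cannot change its old
          -- colour.
          obtain rfl : k = k' := hb.2 k hk k' hk' (hUN k ih.1) ⟨d, hdk', hbd⟩
          refine ⟨hdk', ih.2.tail ⟨ih.1, hdk', hbd.trans ?_⟩⟩
          calc r ≤ r + 2 * r := le_self_add
            _ = 3 * r := by ring
      exact (hU k hk x hxk y key.2).trans le_self_add
  · intro x hx
    obtain ⟨k, hk, hxk⟩ := (memZ x).1 hx
    by_cases hW : x ∈ W
    · refine ⟨k, by omega, c, by omega, by omega, ?_, ?_⟩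
      · simpa [hk] using ⟨hUN k hxk, hx⟩
      · simpa using hW
    · have : ∃ i < c, ∃ j < c, x ∈ N i ∧ x ∈ N j ∧ i ≠ j := by
        by_contra! hcon
        exact hW ⟨hx, hcon⟩
      obtain ⟨i, hi, j, hj, hxi, hxj, hij⟩ := this
      refine ⟨i, by omega, j, by omega, hij, ?_, ?_⟩
      · simpa [hi] using ⟨hxi, hx⟩
      · simpa [hj] using ⟨hxj, hx⟩

/-- The cover consists of components. Distinct ones are at distance at least `2 * s`; the factor 2
yields the strict inequality in `s`-disjointness. -/
theorem Colourable.hasColouredCover {c : ℕ} {s C : ℝ≥0} (hs : 0 < s)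
    (h : Colourable (c + 1) (2 * s) C (Set.univ : Set X)) : HasColouredCover X c s C := by
  obtain ⟨U, hU, hb⟩ := h
  refine ⟨fun i => {V | ∃ x ∈ U i, V = component (2 * s) (U i) x}, ?_, fun i => ⟨?_, ?_⟩⟩
  · refine Set.eq_univ_of_forall fun x => ?_
    have hx : x ∈ ⋃ i < c + 1, U i := hU ▸ Set.mem_univ x
    simp only [Set.mem_iUnion] at hx ⊢
    obtain ⟨i, hi, hx⟩ := hx
    exact ⟨⟨i, hi⟩, _, ⟨x, hx, rfl⟩, hx, .refl⟩
  · rintro _ ⟨x, hx, rfl⟩ _ ⟨y, hy, rfl⟩ hne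
    refine lt_of_lt_of_le (b := ((2 * s : ℝ≥0) : ℝ≥0∞)) ?_ ?_
    · rw [ENNReal.coe_lt_coe, two_mul]
      exact lt_add_of_pos_left s hs
    · refine le_iInf₂ fun a ha => le_iInf₂ fun b hb' => ?_
      by_contra! hlt
      rw [edist_nndist, ENNReal.coe_lt_coe] at hlt
      have hxy : Relation.ReflTransGen (Step (2 * s) (U i)) x y :=
        (Relation.ReflTransGen.tail ha.2 ⟨ha.1, hb'.1, hlt.le⟩).trans (chain_symm hb'.2)
      refine hne (Set.ext fun z => ⟨fun hz => ⟨hz.1, (chain_symm hxy).trans hz.2⟩,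
        fun hz => ⟨hz.1, hxy.trans hz.2⟩⟩)
  · rintro _ ⟨x, hx, rfl⟩
    exact chainBounded_iff.1 (hb i i.2) x hx

theorem IsDisjointFamily.anti {s s' : ℝ≥0} {𝒰 : Set (Set X)} (h : IsDisjointFamily s 𝒰)
    (hs : s' ≤ s) : IsDisjointFamily s' 𝒰 := fun U hU V hV hne =>
  lt_of_le_of_lt (ENNReal.coe_le_coe.2 hs) (h U hU V hV hne)

theorem HasColouredCover.mono {n : ℕ} {s s' C C' : ℝ≥0} (h : HasColouredCover X n s C)
    (hs : s' ≤ s) (hC : C ≤ C') : HasColouredCover X n s' C' := by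
  obtain ⟨𝒰, h𝒰, h⟩ := h
  exact ⟨𝒰, h𝒰, fun i => ⟨(h i).1.anti hs,
    fun U hU => ((h i).2 U hU).trans (ENNReal.coe_le_coe.2 hC)⟩⟩

end Chains

/-! ### Adding the preimage of one disjoint family. -/

section Fibres

variable {X Y : Type*} [MetricSpace X] [MetricSpace Y] {f : X → Y}

theorem FibresDecompose.mono {m : ℕ} {r r' R R' C C' : ℝ≥0} (h : FibresDecompose f m r R C)
    (hr : r' ≤ r) (hR : R' ≤ R) (hC : C ≤ C') : FibresDecompose f m r' R' C' := by
  intro A hA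
  obtain ⟨B, hAB, hB⟩ := h A fun x hx y hy hxy => (hA x hx y hy hxy).trans hR
  exact ⟨B, hAB, fun i => chainBounded_iff.1 ((chainBounded_iff.2 (hB i)).mono hr hC le_rfl)⟩

theorem FibresDecompose.colourable {m c : ℕ} {r R C : ℝ≥0} (h : FibresDecompose f m r R C)
    (hc : m + 1 ≤ c) {V : Set Y} (hV : IsBoundedBy R V) : Colourable c r C (f ⁻¹' V) := by
  obtain ⟨B, hAB, hB⟩ := h (f ⁻¹' V) fun x hx y hy _ => isBoundedBy_iff.1 hV _ hx _ hy
  refine ⟨fun i => if hi : i < m + 1 then B ⟨i, hi⟩ else ∅, ?_, ?_⟩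
  · rw [hAB]
    ext x
    simp only [Set.mem_iUnion]
    constructor
    · rintro ⟨i, hi⟩
      exact ⟨i, by omega, by rw [dif_pos i.2]; exact hi⟩
    · rintro ⟨i, -, hx⟩
      split_ifs at hx with hi
      · exact ⟨_, hx⟩
      · exact hx.elim
  · intro i _
    dsimp only
    split_ifs with hi
    · exact chainBounded_iff.2 (hB _)
    · exact chainBounded_empty _ _

/-- Members of a disjoint family that come close to a common pair of points coincide. -/
theorem IsDisjointFamily.eq_of_infEDist_lt {L s t : ℝ≥0} {𝒱 : Set (Set Y)}
    (h : IsDisjointFamily L 𝒱) (hL : 2 * t + s ≤ L) {V V' : Set Y} (hV : V ∈ 𝒱) (hV' : V' ∈ 𝒱)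
    {y y' : Y} (hy : Metric.infEDist y V < t) (hy' : Metric.infEDist y' V' < t)
    (hyy' : nndist y y' ≤ s) : V = V' := by
  by_contra hne
  obtain ⟨v, hv, hyv⟩ := Metric.infEDist_lt_iff.1 hy
  obtain ⟨v', hv', hyv'⟩ := Metric.infEDist_lt_iff.1 hy'
  have h1 : (L : ℝ≥0∞) < edist v v' :=
    (h V hV V' hV' hne).trans_le (iInf₂_le_of_le v hv (iInf₂_le v' hv'))
  rw [edist_nndist, ENNReal.coe_lt_coe] at h1 hyv hyv'
  refine absurd h1 (not_lt.2 (le_trans ?_ hL))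
  calc nndist v v' ≤ nndist v y + nndist y y' + nndist y' v' :=
        (nndist_triangle v y' v').trans (add_le_add_left (nndist_triangle v y y') _)
    _ ≤ t + s + t := by
        rw [nndist_comm v y]
        gcongr
    _ = 2 * t + s := by ring

theorem exists_infEDist_lt_of_sUnion {𝒱 : Set (Set Y)} {y : Y} {t : ℝ≥0∞}
    (h : Metric.infEDist y (⋃₀ 𝒱) < t) : ∃ V ∈ 𝒱, Metric.infEDist y V < t := by
  obtain ⟨v, ⟨V, hV, hv⟩, hyv⟩ := Metric.infEDist_lt_iff.1 h
  exact ⟨V, hV, (Metric.infEDist_le_edist_of_mem hv).trans_lt hyv⟩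

/-- Adding the preimage of one disjoint bounded family costs one colour. -/
theorem Colourable.union_preimage {m c : ℕ} {r r' s L B R C : ℝ≥0} {Z : Set X}
    (hZ : Colourable c (3 * r) B Z) (hmc : m ≤ c) (hs : 0 < s)
    (hf : ∀ a b, nndist a b ≤ r → nndist (f a) (f b) ≤ s)
    (hr' : B + 4 * r ≤ r') (hD : FibresDecompose f m r' R C)
    {𝒱 : Set (Set Y)} (hL : (2 * c + 3) * s ≤ L) (h𝒱 : IsDisjointFamily L 𝒱)
    (hb : ∀ V ∈ 𝒱, IsBoundedBy R V) :
    Colourable (c + 1) r (C + 2 * B + 6 * r) (Z ∪ f ⁻¹' ⋃₀ 𝒱) := by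
  obtain ⟨U, hUZ, hU, htwo⟩ := hZ.exists_two
  have hP : ∀ V : Set Y, ∃ P : ℕ → Set X, V ∈ 𝒱 →
      (f ⁻¹' V = ⋃ i < c + 1, P i ∧ ∀ i < c + 1, ChainBounded r' C (P i)) := by
    intro V
    by_cases hV : V ∈ 𝒱
    · obtain ⟨P, hP⟩ := hD.colourable (c := c + 1) (by omega) (hb V hV)
      exact ⟨P, fun _ => hP⟩
    · exact ⟨fun _ => ∅, fun h => (hV h).elim⟩
  choose P hP using hP
  have hPV : ∀ V ∈ 𝒱, ∀ i < c + 1, ∀ x ∈ P V i, f x ∈ V := fun V hV i hi x hx => by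
    have : x ∈ f ⁻¹' V := by
      rw [(hP V hV).1]
      exact Set.mem_iUnion₂.2 ⟨i, hi, hx⟩
    exact this
  let e : X → ℝ≥0∞ := fun x => Metric.infEDist (f x) (⋃₀ 𝒱)
  have he : ∀ a b, nndist a b ≤ r → e b ≤ e a + s := fun a b hab => by
    refine Metric.infEDist_le_infEDist_add_edist.trans (add_le_add_right ?_ _)
    rw [edist_comm, edist_nndist, ENNReal.coe_le_coe]
    exact hf a b hab
  -- The preimage of the `i`-th shell; its width `s` bounds the change of `e` along one step.
  let G : ℕ → Set X := fun i => {x | (i * s : ℝ≥0∞) < e x ∧ e x ≤ ((i + 1 : ℕ) : ℝ≥0∞) * s}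
  have hG : ∀ i j x, i < j → x ∈ G i → x ∉ G j := fun i j x hij hi hj => by
    refine absurd (hj.1.trans_le hi.2) (not_lt.2 ?_)
    gcongr
    exact_mod_cast hij
  refine ⟨fun i => (U i \ G i) ∪ ⋃ V ∈ 𝒱, P V i, ?_, ?_⟩
  · ext x
    simp only [Set.mem_union, Set.mem_iUnion]
    constructor
    · rintro (hx | ⟨V, hV, hx⟩)
      · obtain ⟨i, hi, j, hj, hij, hxi, hxj⟩ := htwo x hx
        by_cases hxG : x ∈ G i
        · refine ⟨j, hj, .inl ⟨hxj, fun h => ?_⟩⟩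
          rcases lt_or_gt_of_ne hij with h' | h'
          · exact hG i j x h' hxG h
          · exact hG j i x h' h hxG
        · exact ⟨i, hi, .inl ⟨hxi, hxG⟩⟩
      · have : x ∈ f ⁻¹' V := hx
        rw [(hP V hV).1] at this
        obtain ⟨i, hi, hx⟩ := Set.mem_iUnion₂.1 this
        exact ⟨i, hi, .inr ⟨V, hV, hx⟩⟩
    · rintro ⟨i, hi, hx | ⟨V, hV, hx⟩⟩
      · exact .inl (hUZ i hi hx.1)
      · exact .inr ⟨V, hV, hPV V hV i hi x hx⟩
  · intro i hi x hx y hxy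
    have hzero : ∀ z V, V ∈ 𝒱 → z ∈ P V i → e z = 0 := fun z V hV hz =>
      Metric.infEDist_zero_of_mem ⟨V, hV, hPV V hV i hi z hz⟩
    by_cases hx0 : e x ≤ i * s
    · have hlt : ∀ z, e z ≤ i * s → e z < (((i + 1 : ℕ) * s : ℝ≥0) : ℝ≥0∞) := fun z hz => by
        refine hz.trans_lt ?_
        have : ((i : ℝ≥0∞) * s) = ((i * s : ℝ≥0) : ℝ≥0∞) := by push_cast; rfl
        rw [this, ENNReal.coe_lt_coe]
        gcongr
        exact_mod_cast i.lt_succ_self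
      -- Two members within `(i + 1) * s` of the ends of one step must coincide; the worst case `i =
      -- c` explains the factor `2 * c + 3`.
      have hcons : 2 * (((i + 1 : ℕ) : ℝ≥0) * s) + s ≤ L := by
        refine le_trans ?_ hL
        have hic : ((i : ℝ≥0)) ≤ c := by exact_mod_cast Nat.lt_succ_iff.1 hi
        calc 2 * (((i + 1 : ℕ) : ℝ≥0) * s) + s = (2 * i + 3) * s := by push_cast; ring
          _ ≤ _ := by gcongr
      obtain ⟨V, hV, hxV⟩ := exists_infEDist_lt_of_sUnion (hlt x hx0)
      have hclose : ∀ z V', V' ∈ 𝒱 → z ∈ P V' i →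
          Metric.infEDist (f z) V' < (((i + 1 : ℕ) * s : ℝ≥0) : ℝ≥0∞) := fun z V' hV' hz => by
        rw [Metric.infEDist_zero_of_mem (hPV V' hV' i hi z hz), ENNReal.coe_pos]
        positivity
      have hmem : ∀ z, z ∈ (U i \ G i) ∪ ⋃ V ∈ 𝒱, P V i →
          Metric.infEDist (f z) V < (((i + 1 : ℕ) * s : ℝ≥0) : ℝ≥0∞) → z ∈ U i ∪ P V i := by
        intro z hz hzV
        rcases hz with hz | hz
        · exact .inl hz.1
        · obtain ⟨V', hV', hz⟩ := Set.mem_iUnion₂.1 hz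
          obtain rfl := h𝒱.eq_of_infEDist_lt hcons hV hV' hzV (hclose z V' hV' hz) (by simp)
          exact .inr hz
      have key : e y ≤ i * s ∧ Metric.infEDist (f y) V < (((i + 1 : ℕ) * s : ℝ≥0) : ℝ≥0∞) ∧
          Relation.ReflTransGen (Step r (U i ∪ P V i)) x y := by
        induction hxy with
        | refl => exact ⟨hx0, hxV, .refl⟩
        | @tail b d _ hs' ih =>
          obtain ⟨hb', hd, hbd⟩ := hs'
          have hd0 : e d ≤ i * s := by
            rcases hd with hd | hd
            -- Leaving the inner region in one step would land in the erased shell.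
            · by_contra! hcon
              refine hd.2 ⟨hcon, (he b d hbd).trans ?_⟩
              push_cast
              rw [add_mul, one_mul]
              gcongr
              exact ih.1
            · obtain ⟨V', hV', hz⟩ := Set.mem_iUnion₂.1 hd
              rw [hzero d V' hV' hz]
              exact zero_le
          obtain ⟨V', hV', hdV'⟩ := exists_infEDist_lt_of_sUnion (hlt d hd0)
          obtain rfl := h𝒱.eq_of_infEDist_lt hcons hV hV' ih.2.1 hdV' (hf b d hbd)
          exact ⟨hd0, hdV', ih.2.2.tail ⟨hmem b hb' ih.2.1, hmem d hd hdV', hbd⟩⟩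
      -- With `β = B + 2 * r`, the scale required of `r'` is `β + 2 * r = B + 4 * r`.
      have hbound := ((hU i hi).union ((hP V hV).2 i hi)
        (le_trans (le_of_eq (by ring)) hr')) x (hmem x hx hxV) y key.2.2
      exact hbound.trans (le_of_eq (by ring))
    · have hfar : ∀ z, z ∈ (U i \ G i) ∪ ⋃ V ∈ 𝒱, P V i → (i * s : ℝ≥0∞) < e z →
          z ∈ U i ∧ ((i + 1 : ℕ) : ℝ≥0∞) * s < e z := by
        intro z hz hlt
        rcases hz with hz | hz
        · exact ⟨hz.1, not_le.1 fun h => hz.2 ⟨hlt, h⟩⟩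
        · obtain ⟨V', hV', hz⟩ := Set.mem_iUnion₂.1 hz
          rw [hzero z V' hV' hz] at hlt
          exact (not_lt_zero hlt).elim
      rw [not_le] at hx0
      have key : (i * s : ℝ≥0∞) < e y ∧ Relation.ReflTransGen (Step r (U i)) x y := by
        induction hxy with
        | refl => exact ⟨hx0, .refl⟩
        | @tail b d _ hs' ih =>
          obtain ⟨hb', hd, hbd⟩ := hs'
          have hb1 := hfar b hb' ih.1
          have hd0 : (i * s : ℝ≥0∞) < e d := by
            by_contra! hcon
            refine absurd hb1.2 (not_lt.2 ((he d b (by rwa [nndist_comm])).trans ?_))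
            push_cast
            rw [add_mul, one_mul]
            gcongr
          exact ⟨hd0, ih.2.tail ⟨hb1.1, (hfar d hd hd0).1, hbd⟩⟩
      refine (hU i hi x (hfar x hx hx0).1 y key.2).trans ?_
      calc B + 2 * r ≤ B + 2 * r + (C + B + 4 * r) := le_self_add
        _ = _ := by ring

end Fibres

/-! ### Induction over the families, at the scales along a filter. -/

section Abstract

/-- The properties of control semigroups and of global control semigroups that concern only the
behaviour along a filter, `atTop` or `𝓝[>] 0 ⊔ atTop`. -/
structure IsControlAlong (l : Filter ℝ≥0) (S : Set (ℝ≥0 → ℝ≥0)) : Prop where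
  mono : ∀ g ∈ S, Monotone g
  le : ∀ g ∈ S, ∀ᶠ x in l, x ≤ g x
  tendsto : ∀ g ∈ S, Tendsto g l l
  mul_left : ∀ c : ℝ≥0, 1 ≤ c → (fun x => c * x) ∈ S
  comp : ∀ f ∈ S, ∀ g ∈ S, f ∘ g ∈ S

variable {l : Filter ℝ≥0} {S₁ S₂ : Set (ℝ≥0 → ℝ≥0)}

theorem IsControlAlong.const_mul (h : IsControlAlong l S₁) {c : ℝ≥0} (hc : 1 ≤ c)
    {g : ℝ≥0 → ℝ≥0} (hg : g ∈ S₁) : (fun x => c * g x) ∈ S₁ := h.comp _ (h.mul_left c hc) g hg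

variable {X Y : Type*} [MetricSpace X] [MetricSpace Y] {f : X → Y}

/-- Each round divides the chain scale by 3, hence the factor `3 ^ j` and the quantification over
`κ` inside the induction. The bound `ρ` is fixed before the families, which may vary with `x`. -/
theorem exists_colourable_preimage (h₁ : IsControlAlong l S₁) {m : ℕ}
    (hD : ∀ ρ ∈ S₁, ∀ δ ∈ S₂, ∃ ρ' ∈ S₁, ∀ᶠ x in l, FibresDecompose f m (ρ x) (δ x) (ρ' x))
    {δ : ℝ≥0 → ℝ≥0} (hδ : δ ∈ S₂) (s : ℝ≥0 → ℝ≥0) (hs : ∀ᶠ x in l, 0 < s x) (j : ℕ) :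
    ∀ κ : ℝ≥0, (∀ᶠ x in l, ∀ a b, nndist a b ≤ 3 ^ j * κ * x → nndist (f a) (f b) ≤ s x) →
    ∃ ρ ∈ S₁, ∀ᶠ x in l, ∀ 𝒱 : ℕ → Set (Set Y),
      (∀ i < j, IsDisjointFamily ((2 * (m + j : ℕ) + 3) * s x) (𝒱 i) ∧
        ∀ V ∈ 𝒱 i, IsBoundedBy (δ x) V) →
      Colourable (m + j) (κ * x) (ρ x) (⋃ i < j, f ⁻¹' ⋃₀ 𝒱 i) := by
  induction j with
  | zero =>
    intro κ _
    refine ⟨_, h₁.mul_left 1 le_rfl, .of_forall fun x 𝒱 _ => ⟨fun _ => ∅, by simp, ?_⟩⟩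
    exact fun _ _ => chainBounded_empty _ _
  | succ j ih =>
    intro κ hf
    obtain ⟨ρ, hρ, hρU⟩ := ih (3 * κ) (hf.mono fun x h => by
      rwa [show (3 : ℝ≥0) ^ j * (3 * κ) * x = 3 ^ (j + 1) * κ * x by ring])
    -- The scale `(1 + 4 * κ) * ρ x` dominates the required `ρ x + 4 * (κ * x)`, since `x ≤ ρ x`
    -- along `l`.
    obtain ⟨ρ', hρ', hdec⟩ := hD _ (h₁.const_mul (c := 1 + 4 * κ) le_self_add hρ) δ hδ
    refine ⟨_, h₁.const_mul (c := 3 + 6 * κ)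
      (le_add_right (by norm_num)) (h₁.comp ρ' hρ' ρ hρ), ?_⟩
    filter_upwards [hs, hf, hρU, hdec, h₁.le ρ hρ, (h₁.tendsto ρ hρ).eventually (h₁.le ρ' hρ')]
      with x hsx hfx hUx hdx hle hle' 𝒱 h𝒱
    have hstep := (hUx 𝒱 fun i hi => ⟨(h𝒱 i (by omega)).1.anti (by gcongr; omega),
      (h𝒱 i (by omega)).2⟩)
    rw [mul_assoc] at hstep
    have hL : (2 * ((m + j : ℕ) : ℝ≥0) + 3) * s x ≤ (2 * ((m + (j + 1) : ℕ) : ℝ≥0) + 3) * s x := by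
      gcongr
      omega
    have hnew := hstep.union_preimage (f := f) (Nat.le_add_right m j) hsx
      (fun a b hab => hfx a b (hab.trans (by
        rw [mul_assoc]
        exact le_mul_of_one_le_left (zero_le) (one_le_pow₀ (by norm_num)))))
      (r' := (1 + 4 * κ) * ρ x) (by
        calc ρ x + 4 * (κ * x) ≤ ρ x + 4 * (κ * ρ x) := by gcongr
          _ = _ := by ring) hdx hL (h𝒱 j (by omega)).1 (h𝒱 j (by omega)).2
    obtain ⟨U, hU, hUb⟩ := hnew
    refine ⟨U, ?_, fun i hi => (hUb i hi).mono le_rfl ?_ le_rfl⟩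
    · rw [Set.biUnion_lt_succ]
      exact hU
    · have h1 : ρ' x ≤ ρ' (ρ x) := h₁.mono ρ' hρ' hle
      calc ρ' x + 2 * ρ x + 6 * (κ * x)
          ≤ ρ' (ρ x) + 2 * ρ' (ρ x) + 6 * (κ * ρ' (ρ x)) := by
            gcongr
            exact hle.trans hle'
        _ = (3 + 6 * κ) * ρ' (ρ x) := by ring

/-- The Hurewicz type inequality for covers at the scales along a filter. -/
theorem exists_hasColouredCover (hl : ∀ᶠ x in l, 0 < x) (h₁ : IsControlAlong l S₁)
    (h₂ : IsControlAlong l S₂) {m n : ℕ}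
    (hf : ∃ g ∈ S₂, ∀ᶠ x in l, ∀ a b, nndist a b ≤ x → nndist (f a) (f b) ≤ g x)
    (hD : ∀ ρ ∈ S₁, ∀ δ ∈ S₂, ∃ ρ' ∈ S₁, ∀ᶠ x in l, FibresDecompose f m (ρ x) (δ x) (ρ' x))
    (hY : ∃ g ∈ S₂, ∀ᶠ x in l, HasColouredCover Y n x (g x)) :
    ∃ g ∈ S₁, ∀ᶠ x in l, HasColouredCover X (m + n) x (g x) := by
  obtain ⟨h, hh, hf⟩ := hf
  obtain ⟨g, hg, hY⟩ := hY
  -- Displacement in `Y` of a step at the coarsest scale: `n + 1` triplings of the final scale `2 *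
  -- x`.
  let σ : ℝ≥0 → ℝ≥0 := fun x => h (3 ^ (n + 1) * 2 * x)
  have h3 : (1 : ℝ≥0) ≤ 3 ^ (n + 1) * 2 :=
    one_le_mul_of_one_le_of_one_le (one_le_pow₀ (by norm_num)) (by norm_num)
  have hlin := h₂.mul_left _ h3
  have hσ : σ ∈ S₂ := h₂.comp h hh _ hlin
  let L : ℝ≥0 := 2 * (m + (n + 1) : ℕ) + 3
  have hLσ : (fun x => L * σ x) ∈ S₂ := h₂.const_mul (le_add_left (by norm_num)) hσ
  obtain ⟨ρ, hρ, hcol⟩ := exists_colourable_preimage h₁ hD (h₂.comp g hg _ hLσ) σ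
    ((h₂.tendsto σ hσ).eventually hl) (n + 1) 2 ((h₂.tendsto _ hlin).eventually hf)
  refine ⟨ρ, hρ, ?_⟩
  filter_upwards [hl, hcol, (h₂.tendsto _ hLσ).eventually hY] with x hx hcx hYx
  obtain ⟨𝒰, hcov, h𝒰⟩ := hYx
  have hcol := hcx (fun i => if hi : i < n + 1 then 𝒰 ⟨i, hi⟩ else ∅) fun i hi => by
    simp only [dif_pos hi]
    exact h𝒰 _
  refine Colourable.hasColouredCover hx ?_
  suffices hcover : (⋃ i < n + 1, f ⁻¹' ⋃₀ if hi : i < n + 1 then 𝒰 ⟨i, hi⟩ else ∅) = Set.univ by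
    rwa [hcover] at hcol
  refine Set.eq_univ_of_forall fun z => ?_
  have hz : f z ∈ ⋃ i, ⋃₀ 𝒰 i := hcov ▸ Set.mem_univ _
  obtain ⟨i, hi⟩ := Set.mem_iUnion.1 hz
  refine Set.mem_iUnion₂.2 ⟨i, i.2, ?_⟩
  rw [dif_pos i.2]
  exact hi

end Abstract

/-! ### From the two kinds of semigroup to filters, and intermediate scales. -/

section Semigroups

variable {S T : Set (ℝ≥0 → ℝ≥0)}

theorem strictMono_mul_left {c : ℝ≥0} (hc : 1 ≤ c) : StrictMono fun x : ℝ≥0 => c * x :=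
  fun _ _ h => mul_lt_mul_of_pos_left h (zero_lt_one.trans_le hc)

theorem isGlobalDimControl_mul_left {c : ℝ≥0} (hc : 1 ≤ c) :
    IsGlobalDimControl fun x => c * x where
  mono := (strictMono_mul_left hc).monotone
  cont := by fun_prop
  le_atTop := .of_forall fun x => le_mul_of_one_le_left zero_le hc
  tendsto_atTop := tendsto_atTop_mono (fun x => le_mul_of_one_le_left zero_le hc) tendsto_id
  le_zero := .of_forall fun x => le_mul_of_one_le_left zero_le hc
  map_zero := by simp

theorem IsControlSemigroup.isControlAlong (h : IsControlSemigroup S) :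
    IsControlAlong atTop S where
  mono g hg := (h.dimControl g hg).mono
  le g hg := (h.dimControl g hg).le_atTop
  tendsto g hg := (h.dimControl g hg).tendsto_atTop
  mul_left c hc := h.linear _ (strictMono_mul_left hc)
    (isGlobalDimControl_mul_left hc).toIsDimControl ⟨c, .of_forall fun _ => rfl⟩
  comp := h.comp

theorem IsGlobalDimControl.tendsto_zero {g : ℝ≥0 → ℝ≥0} (h : IsGlobalDimControl g) :
    Tendsto g (𝓝[>] 0) (𝓝[>] 0) := by
  refine tendsto_nhdsWithin_iff.2 ⟨?_, ?_⟩
  · have := (h.cont.tendsto 0).mono_left (nhdsWithin_le_nhds (s := Set.Ioi 0))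
    rwa [h.map_zero] at this
  · filter_upwards [h.le_zero, self_mem_nhdsWithin] with x hx hx0
    exact lt_of_lt_of_le hx0 hx

theorem IsGlobalControlSemigroup.isControlAlong (h : IsGlobalControlSemigroup T) :
    IsControlAlong (𝓝[>] 0 ⊔ atTop) T where
  mono g hg := (h.dimControl g hg).mono
  le g hg := eventually_sup.2 ⟨(h.dimControl g hg).le_zero, (h.dimControl g hg).le_atTop⟩
  tendsto g hg := (h.dimControl g hg).tendsto_zero.sup_sup (h.dimControl g hg).tendsto_atTop
  mul_left c hc := h.linear _ (strictMono_mul_left hc) (isGlobalDimControl_mul_left hc)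
    ⟨c, .of_forall fun _ => rfl⟩ ⟨c, .of_forall fun _ => rfl⟩
  comp := h.comp

/-- A function of a global control semigroup can be enlarged to be big away from `0`. -/
theorem IsGlobalControlSemigroup.exists_large (h : IsGlobalControlSemigroup T) {g : ℝ≥0 → ℝ≥0}
    (hg : g ∈ T) {a : ℝ≥0} (ha : 0 < a) (C : ℝ≥0) :
    ∃ g' ∈ T, g ≤ g' ∧ ∀ x, a ≤ x → C ≤ g' x := by
  obtain ⟨M, hM⟩ := ((h.dimControl g hg).tendsto_atTop.eventually_ge_atTop C).exists
  let c : ℝ≥0 := M / a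
  -- By truncated subtraction `p` is the identity up to `a / 2`; from `a` on it has slope `1 + c`,
  -- so it exceeds `c * a = M` there. The summand `x` makes it strictly increasing.
  let p : ℝ≥0 → ℝ≥0 := fun x => x + min (c * x) (c * (2 * x - a))
  have hxp : ∀ x, x ≤ p x := fun x => le_self_add
  have hmono : StrictMono p := fun x y hxy => add_lt_add_of_lt_of_le hxy (by gcongr)
  have hzero : ∀ᶠ x in 𝓝[>] (0 : ℝ≥0), p x = 1 * x := by
    filter_upwards [mem_nhdsWithin_of_mem_nhds (Iio_mem_nhds (half_pos ha))] with x hx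
    have h2 : 2 * x ≤ a := by
      calc 2 * x ≤ 2 * (a / 2) := by gcongr; exact hx.le
        _ = a := mul_div_cancel₀ a two_ne_zero
    simp [p, tsub_eq_zero_of_le h2]
  have hlarge : ∀ x, a ≤ x → p x = (1 + c) * x := fun x hx => by
    have : x ≤ 2 * x - a := le_tsub_of_add_le_right (by rw [two_mul]; gcongr)
    simp only [p]
    rw [min_eq_left (by gcongr), add_mul, one_mul]
  have hp : p ∈ T := by
    refine h.linear p hmono ⟨⟨hmono.monotone, by fun_prop, .of_forall hxp,
      tendsto_atTop_mono hxp tendsto_id⟩, .of_forall hxp, by simp [p]⟩ ⟨1, hzero⟩ ⟨1 + c, ?_⟩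
    filter_upwards [eventually_ge_atTop a] with x hx using hlarge x hx
  have hg_mono := (h.dimControl g hg).mono
  refine ⟨g ∘ p, h.comp g hg p hp, fun x => hg_mono (hxp x), fun x hx => hM.trans (hg_mono ?_)⟩
  rw [hlarge x hx]
  calc M = c * a := (div_mul_cancel₀ M ha.ne').symm
    _ ≤ (1 + c) * x := by gcongr; exact le_add_self

/-- Scales between the two neighbourhoods lie in a bounded interval `[a, b]`; the cover at scale `b`
serves them all once the control function is at least `g b` from `a` on. -/
theorem IsGlobalControlSemigroup.globalDimLE (h : IsGlobalControlSemigroup T) {X : Type*}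
    [MetricSpace X] {n : ℕ}
    (hX : ∃ g ∈ T, ∀ᶠ x in 𝓝[>] 0 ⊔ atTop, HasColouredCover X n x (g x)) :
    GlobalDimLE T X n := by
  obtain ⟨g, hg, hX⟩ := hX
  obtain ⟨h0, htop⟩ := eventually_sup.1 hX
  obtain ⟨a, ha, h0⟩ := mem_nhdsGT_iff_exists_Ioo_subset.1 h0
  obtain ⟨b, htop⟩ := eventually_atTop.1 htop
  obtain ⟨g', hg', hle, hC⟩ := h.exists_large hg ha (g b)
  refine ⟨g', hg', fun s hs => ?_⟩
  rcases lt_or_ge s a with hsa | hsa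
  · exact HasColouredCover.mono (h0 ⟨hs, hsa⟩) le_rfl (hle s)
  · rcases le_total s b with hsb | hsb
    · exact (htop b le_rfl).mono hsb (hC s hsa)
    · exact (htop s hsb).mono le_rfl (hle s)

end Semigroups

/-! ### Least dimensions and the theorem. -/

theorem iInf_natCast_le_add {P Q R : ℕ → Prop} (h : ∀ m n, Q m → R n → P (m + n)) :
    (⨅ (n : ℕ) (_ : P n), (n : ℕ∞)) ≤
      (⨅ (n : ℕ) (_ : Q n), (n : ℕ∞)) + ⨅ (n : ℕ) (_ : R n), (n : ℕ∞) := by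
  have attained : ∀ Q : ℕ → Prop, (⨅ (n : ℕ) (_ : Q n), (n : ℕ∞)) = ⊤ ∨
      ∃ k, Q k ∧ (⨅ (n : ℕ) (_ : Q n), (n : ℕ∞)) = k := by
    intro Q
    by_cases hQ : ∃ k, Q k
    · classical
      refine .inr ⟨Nat.find hQ, Nat.find_spec hQ, le_antisymm
        (iInf₂_le _ (Nat.find_spec hQ)) (le_iInf₂ fun n hn => ?_)⟩
      exact_mod_cast Nat.find_min' hQ hn
    · push Not at hQ
      exact .inl (by simp [hQ])
  rcases attained Q with hQ | ⟨m, hm, hQ⟩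
  · simp [hQ]
  rcases attained R with hR | ⟨n, hn, hR⟩
  · simp [hR]
  rw [hQ, hR]
  exact_mod_cast iInf₂_le (m + n) (h m n hm hn)

end ControlledDim

theorem mainTheorem1 {X : Type*} {Y : Type*} [MetricSpace X] [MetricSpace Y] (f : X → Y) :
    (∀ S₁ S₂ : Set (ℝ≥0 → ℝ≥0), IsControlSemigroup S₁ → IsControlSemigroup S₂ →
      IsCoarseMap S₂ f →
        asdim S₁ X ≤ asdimMap S₁ S₂ f + asdim S₂ Y) ∧
    (∀ T₁ T₂ : Set (ℝ≥0 → ℝ≥0), IsGlobalControlSemigroup T₁ → IsGlobalControlSemigroup T₂ →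
      IsGlobalMap T₂ f →
        globalDim T₁ X ≤ globalDimMap T₁ T₂ f + globalDim T₂ Y) := by
  refine ⟨fun S₁ S₂ h₁ h₂ hf => iInf_natCast_le_add ?_,
    fun T₁ T₂ h₁ h₂ hf => iInf_natCast_le_add ?_⟩
  · rintro m n ⟨D, hD, t, ht⟩ hY
    obtain ⟨ρ, ⟨hρ, -, -, g, hg, hρg⟩, hfρ⟩ := hf
    refine exists_hasColouredCover (eventually_gt_atTop 0) h₁.isControlAlong h₂.isControlAlong
      ⟨g, hg, hρg.mono fun x hx a b hab => (hfρ a b).trans ((hρ hab).trans hx)⟩ ?_ hY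
    intro ρ₁ hρ₁ δ hδ
    obtain ⟨ρ₂, hρ₂, hle⟩ := hD ρ₁ hρ₁ δ hδ
    refine ⟨ρ₂, hρ₂, ?_⟩
    filter_upwards [hle, (h₁.isControlAlong.tendsto ρ₁ hρ₁).eventually_ge_atTop t,
      (h₂.isControlAlong.tendsto δ hδ).eventually_ge_atTop t] with x hx hr hR
    exact (ht _ _ hr hR).mono le_rfl le_rfl hx
  · rintro m n ⟨D, hD, ⟨t, ht0, ht⟩, t', ht'⟩ ⟨gY, hgY, hY⟩
    obtain ⟨ρ, ⟨hρ, -, -, -, g, hg, hρg0, hρg⟩, hfρ⟩ := hf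
    have hpos : ∀ᶠ x : ℝ≥0 in 𝓝[>] 0 ⊔ atTop, 0 < x :=
      eventually_sup.2 ⟨self_mem_nhdsWithin, eventually_gt_atTop 0⟩
    refine h₁.globalDimLE (exists_hasColouredCover hpos h₁.isControlAlong h₂.isControlAlong
      ⟨g, hg, (eventually_sup.2 ⟨hρg0, hρg⟩).mono
        fun x hx a b hab => (hfρ a b).trans ((hρ hab).trans hx)⟩ ?_
      ⟨gY, hgY, hpos.mono fun x hx => hY x hx⟩)
    intro ρ₁ hρ₁ δ hδ
    obtain ⟨ρ₂, hρ₂, hle0, hle⟩ := hD ρ₁ hρ₁ δ hδ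
    have c₁ := h₁.dimControl ρ₁ hρ₁
    have c₂ := h₂.dimControl δ hδ
    have hsmall : ∀ᶠ x : ℝ≥0 in 𝓝[>] 0, 0 < x ∧ x ≤ t :=
      -- Positivity matters: near 0 the decompositions are available only for positive `r` and `R`.
      eventually_and.2 ⟨self_mem_nhdsWithin, mem_nhdsWithin_of_mem_nhds (Iic_mem_nhds ht0)⟩
    refine ⟨ρ₂, hρ₂, eventually_sup.2 ⟨?_, ?_⟩⟩
    · filter_upwards [hle0, c₁.tendsto_zero.eventually hsmall, c₂.tendsto_zero.eventually hsmall]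
        with x hx hr hR
      exact (ht _ _ hr.1 hr.2 hR.1 hR.2).mono le_rfl le_rfl hx
    · filter_upwards [hle, c₁.tendsto_atTop.eventually_ge_atTop t',
        c₂.tendsto_atTop.eventually_ge_atTop t'] with x hx hr hR
      exact (ht' _ _ hr hR).mono le_rfl le_rfl hx
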